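/- Let $D$ be a finite digraph (parallel arcs allowed, loops not), let $k>0$ be an integer, let $I_1,\dots,I_l$ be a partition of $[k]=\{1,\dots,k\}$ into nonempty blocks, let $c'_1,\dots,c'_l$ be nonnegative integers, and let $U_1,\dots,U_k\subseteq V(D)$ satisfy $\sum_{i\in I_\alpha}|U_i|\le c'_\alpha$ for $1\le\alpha\le l$. An $r$-arborescence is a digraph whose underlying undirected graph is a tree and in which, for every vertex $u$, there is exactly one directed path from $r$ to $u$; the vertex $r$ is its root. A branching $B$ in $D$ is a spanning subdigraph of $D$ each (weakly connected) component of which is an arborescence; its root set $R(B)$ is the set of the roots of its components. For $X\subseteq V(D)$, let $d_D^-(X)$ be the number of arcs of $D$ with tail outside $X$ and head in $X$, and for $I\subseteq[k]$ let $P_I(X)=\{i\in I: X\cap U_i=\emptyset\}$. Then there exist $k$ pairwise arc-disjoint branchings $B_1,\dots,B_k$ in $D$ such that $U_i\subseteq R(B_i)$ for $1\le i\le k$ and $\sum_{i\in I_\alpha}|R(B_i)|\le c'_\alpha$ for $1\le\alpha\le l$ if and only if, for every $t\ge 0$, all pairwise disjoint nonempty sets $X_1,\dots,X_t\subseteq V(D)$,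 and every $I\subseteq[k]$ that is the union of some (possibly none) of $I_1,\dots,I_l$, $$\sum_{j=1}^{t}\bigl(|P_I(X_j)|-d_D^-(X_j)\bigr)\le\sum_{\alpha:\,I_\alpha\subseteq I}\Bigl(c'_\alpha-\sum_{i\in I_\alpha}|U_i|\Bigr).$$ -/

import Mathlib

/-- A digraph with vertex type `V` and arc type `A`: parallel arcs are allowed, loops are not. -/
structure MultiDigraph (V A : Type*) where
  tail : A → V
  head : A → V
  loopless : ∀ a, tail a ≠ head a

namespace MultiDigraph

variable {V A : Type*}

/-- The in-degree `d⁻(X)`: the number of arcs with tail outside `X` and head in `X`. -/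
def inDegree [Fintype A] [DecidableEq V] (D : MultiDigraph V A) (X : Finset V) : ℕ :=
  (Finset.univ.filter fun a => D.tail a ∉ X ∧ D.head a ∈ X).card

/-- A subdigraph (not necessarily spanning). -/
structure Subdigraph (D : MultiDigraph V A) where
  verts : Set V
  arcs : Set A
  tail_mem : ∀ a ∈ arcs, D.tail a ∈ verts
  head_mem : ∀ a ∈ arcs, D.head a ∈ verts

namespace Subdigraph

variable {D : MultiDigraph V A}

/-- The adjacency relation of the underlying undirected graph of a subdigraph. -/
def underlying (F : D.Subdigraph) : SimpleGraph F.verts where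
  Adj u v := ∃ a ∈ F.arcs,
    (D.tail a = u ∧ D.head a = v) ∨ (D.tail a = v ∧ D.head a = u)
  symm := ⟨fun _ _ ⟨a, ha, h⟩ => ⟨a, ha, h.symm⟩⟩
  loopless := ⟨fun _ ⟨a, _, h⟩ =>
    h.elim (fun h => D.loopless a (h.1.trans h.2.symm))
      (fun h => D.loopless a (h.1.trans h.2.symm))⟩

/-- The underlying undirected multigraph is a tree: no two arcs join the same unordered pair of
vertices, and the graph of adjacencies is a tree. -/
def IsUnderlyingTree (F : D.Subdigraph) : Prop :=
  F.underlying.IsTree ∧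
    ∀ a ∈ F.arcs, ∀ b ∈ F.arcs, s(D.tail a, D.head a) = s(D.tail b, D.head b) → a = b

/-- `F.IsDirWalk u p v`: the list of arcs `p` is a directed walk of `F` from `u` to `v`. -/
def IsDirWalk (F : D.Subdigraph) : V → List A → V → Prop
  | u, [], v => u ∈ F.verts ∧ u = v
  | u, a :: p, v => a ∈ F.arcs ∧ D.tail a = u ∧ F.IsDirWalk (D.head a) p v

/-- A directed path: a directed walk that repeats no vertex. -/
def IsDirPath (F : D.Subdigraph) (u : V) (p : List A) (v : V) : Prop :=
  F.IsDirWalk u p v ∧ (u :: p.map D.head).Nodup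

/-- `F` is an `r`-arborescence: its underlying graph is a tree and, for each vertex `u` of `F`,
there is exactly one directed path in `F` from `r` to `u`. -/
def IsArborescence (F : D.Subdigraph) (r : V) : Prop :=
  r ∈ F.verts ∧ F.IsUnderlyingTree ∧ ∀ u ∈ F.verts, ∃! p : List A, F.IsDirPath r p u

/-- The subdigraph of `F` induced on `S`. -/
def induce (F : D.Subdigraph) (S : Set V) : D.Subdigraph where
  verts := {v | v ∈ F.verts ∧ v ∈ S}
  arcs := {a | a ∈ F.arcs ∧ D.tail a ∈ S ∧ D.head a ∈ S}
  tail_mem a h := ⟨F.tail_mem a h.1, h.2.1⟩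
  head_mem a h := ⟨F.head_mem a h.1, h.2.2⟩

/-- The (weakly connected) component of `F` given by a connected component of its underlying
undirected graph. -/
def component (F : D.Subdigraph) (C : F.underlying.ConnectedComponent) : D.Subdigraph :=
  F.induce (Subtype.val '' C.supp)

/-- A branching of `D`: a spanning subdigraph each component of which is an arborescence. -/
def IsBranching (B : D.Subdigraph) : Prop :=
  B.verts = Set.univ ∧ ∀ C, ∃ r, (B.component C).IsArborescence r

/-- The set of the roots of the components. -/
def rootSet (B : D.Subdigraph) : Set V :=
  {r | ∃ C, (B.component C).IsArborescence r}

end Subdigraph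

end MultiDigraph

/-- `P_I(X)`: the set of all `i ∈ I` with `X ∩ U i = ∅`. -/
def missedBy {V : Type*} [DecidableEq V] {k : ℕ} (U : Fin k → Finset V) (I : Finset (Fin k))
    (X : Finset V) : Finset (Fin k) :=
  I.filter fun i => X ∩ U i = ∅

/-- The family `I₁, …, I_l` is a partition of `[k]` into nonempty blocks. -/
def IsBlockPartition {k l : ℕ} (I : Fin l → Finset (Fin k)) : Prop :=
  (∀ α, (I α).Nonempty) ∧ (∀ α β, α ≠ β → Disjoint (I α) (I β)) ∧
    Finset.univ.biUnion I = Finset.univ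

/-! Necessity: a branching with no root in a nonempty set `X` has an arc entering `X`, so
arc-disjoint branchings with root sets `R i` give `|P(X)| ≤ d⁻(X)` when `P` is taken with respect to
`R`. An index missed by `U i` but not by `R i` has an added root in `X`. Over disjoint sets each
added root is counted at most once (`sum_card_missedBy_sub_le`).

Sufficiency: by Edmonds' theorem (`exists_disjoint_spans`) it suffices to enlarge `U` to root sets
`R` within the budgets so that every nonempty `X` is missed by at most `d⁻(X)` of the `R i`. Roots
are added one at a time, keeping the packing condition (`PackingCondition.exists_insert`). When this
stops, each block has spent its budget or consists of full sets `R i = V`, and the condition for one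
set and the spent blocks is Edmonds' condition.

Suppose a block `α` has budget left and a missing root, but every insertion breaks the condition.
Each insertion then has a violating family of disjoint sets. Take all these families together. The
family of the insertion `(i, v)` contains no set through `v` that counts `i`, so each pair with
index in block `α` is used once less often than there are insertions. A fractional form of the
packing condition (`sum_le_of_separation_le`), obtained by uncrossing to a laminar family and
peeling off minimal members, then makes the positive remaining budget of `α` at most zero. -/

/-! ### Uncrossing and a fractional packing bound. -/

section Uncrossing

variable {V K L : Type*} [DecidableEq V] [DecidableEq K]

/-- Replacing two sets by their intersection and union does not increase how often a pair `(v, i)`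
is separated. -/
theorem countP_separates_inter_union_le (G H : Finset (V ⊕ K)) (F : Multiset (Finset (V ⊕ K)))
    (v : V) (i : K) :
    ((G ∩ H) ::ₘ (G ∪ H) ::ₘ F).countP (fun G => Sum.inl v ∈ G ∧ Sum.inr i ∉ G) ≤
      (G ::ₘ H ::ₘ F).countP (fun G => Sum.inl v ∈ G ∧ Sum.inr i ∉ G) := by
  simp only [Multiset.countP_cons, Finset.mem_inter, Finset.mem_union]
  split_ifs <;> first | omega | (exfalso; tauto)

/-- Strict convexity of the square: the sizes keep their sum but move apart. This makes the
uncrossing terminate. -/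
theorem card_sq_add_card_sq_lt {α : Type*} [DecidableEq α] {G H : Finset α} (h₁ : ¬ G ⊆ H)
    (h₂ : ¬ H ⊆ G) :
    G.card ^ 2 + H.card ^ 2 < (G ∩ H).card ^ 2 + (G ∪ H).card ^ 2 := by
  have e := Finset.card_inter_add_card_union G H
  have l₁ : (G ∩ H).card < G.card := Finset.card_lt_card
    ⟨Finset.inter_subset_left, fun h => h₁ fun x hx => (Finset.mem_inter.1 (h hx)).2⟩
  have l₂ : (G ∩ H).card < H.card := Finset.card_lt_card
    ⟨Finset.inter_subset_right, fun h => h₂ fun x hx => (Finset.mem_inter.1 (h hx)).1⟩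
  obtain ⟨a, ha⟩ := Nat.exists_eq_add_of_lt l₁
  obtain ⟨c, hc⟩ := Nat.exists_eq_add_of_lt l₂
  have : (G ∪ H).card = (G ∩ H).card + a + 1 + c + 1 := by omega
  rw [this, ha, hc]
  nlinarith

/-- A fractional packing bound for a function `p` that is supermodular on pairs of sets meeting in
`V`: if it holds for families that are disjoint on `V`, then it holds for all multisets, the right
side being weighted by bounds `z` on the number of sets that separate a pair `(v, i)`. -/
theorem sum_le_of_separation_le [Fintype V] [Fintype K] [Fintype L] [DecidableEq L]
    (p : Finset (V ⊕ K) → ℤ)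
    (hp : ∀ G H : Finset (V ⊕ K), (∃ v, Sum.inl v ∈ G ∧ Sum.inl v ∈ H) →
      p G + p H ≤ p (G ∩ H) + p (G ∪ H))
    (col : K → L) (b : L → ℤ) (hb : ∀ c, 0 ≤ b c)
    (hdisj : ∀ (M : Finset (Finset (V ⊕ K))) (S : Finset L),
      (∀ G ∈ M, ∃ v, Sum.inl v ∈ G) →
      (∀ G ∈ M, ∀ H ∈ M, (∃ v, Sum.inl v ∈ G ∧ Sum.inl v ∈ H) → G = H) →
      (∀ G ∈ M, ∀ i, Sum.inr i ∉ G → col i ∈ S) → ∑ G ∈ M, p G ≤ ∑ c ∈ S, b c)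
    (F : Multiset (Finset (V ⊕ K))) (hF : ∀ G ∈ F, ∃ v, Sum.inl v ∈ G) (z : L → ℕ)
    (hz : ∀ i v, F.countP (fun G => Sum.inl v ∈ G ∧ Sum.inr i ∉ G) ≤ z (col i)) :
    (F.map p).sum ≤ ∑ c, (z c : ℤ) * b c := by
  classical
  set N := Fintype.card (V ⊕ K) with hN
  have hcard : ∀ G : Finset (V ⊕ K), G.card ^ 2 ≤ N ^ 2 := fun G =>
    Nat.pow_le_pow_left (Finset.card_le_univ G) 2
  -- Uncrossing spreads the sizes and so lowers this measure. The `+ 1` keeps every term positive,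
  -- so deleting members lowers it too.
  induction hm : (F.map fun G => N ^ 2 + 1 - G.card ^ 2).sum using Nat.strong_induction_on
    generalizing F z with
  | _ n ih =>
  by_cases hcross : ∃ G ∈ F, ∃ H ∈ F, (∃ v, Sum.inl v ∈ G ∧ Sum.inl v ∈ H) ∧ ¬ G ⊆ H ∧ ¬ H ⊆ G
  · obtain ⟨G, hG, H, hH, hv, h₁, h₂⟩ := hcross
    obtain ⟨F₁, rfl⟩ := Multiset.exists_cons_of_mem hG
    have hH' : H ∈ F₁ := (Multiset.mem_cons.1 hH).resolve_left fun h => h₁ (h ▸ subset_rfl)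
    obtain ⟨F₂, rfl⟩ := Multiset.exists_cons_of_mem hH'
    have key := ih _ ?_ ((G ∩ H) ::ₘ (G ∪ H) ::ₘ F₂) ?_ z
      (fun i v => (countP_separates_inter_union_le G H F₂ v i).trans (hz i v)) rfl
    · have := hp G H hv
      simp only [Multiset.map_cons, Multiset.sum_cons] at key ⊢
      linarith
    · have h3 := card_sq_add_card_sq_lt h₁ h₂
      have := hcard G
      have := hcard H
      have := hcard (G ∩ H)
      have := hcard (G ∪ H)
      simp only [Multiset.map_cons, Multiset.sum_cons] at hm ⊢
      omega
    · intro X hX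
      obtain ⟨v, hvG, hvH⟩ := hv
      rcases Multiset.mem_cons.1 hX with rfl | hX
      · exact ⟨v, Finset.mem_inter.2 ⟨hvG, hvH⟩⟩
      rcases Multiset.mem_cons.1 hX with rfl | hX
      · exact ⟨v, Finset.mem_union_left _ hvG⟩
      exact hF X (Multiset.mem_cons_of_mem (Multiset.mem_cons_of_mem hX))
  · push Not at hcross
    rcases F.empty_or_exists_mem with rfl | ⟨G₀, hG₀⟩
    · simp only [Multiset.map_zero, Multiset.sum_zero]
      exact Finset.sum_nonneg fun c _ => mul_nonneg (by positivity) (hb c)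
    have hcomp : ∀ G ∈ F, ∀ H ∈ F, (∃ v, Sum.inl v ∈ G ∧ Sum.inl v ∈ H) → G ⊆ H ∨ H ⊆ G :=
      fun G hG H hH hv => or_iff_not_imp_left.2 (hcross G hG H hH hv)
    -- One copy of each inclusion-minimal member; further copies stay in the remainder `F'`.
    set M : Finset (Finset (V ⊕ K)) := F.toFinset.filter fun G => ∀ H ∈ F, H ⊆ G → H = G with hM
    have hMF : M.val ≤ F := (Multiset.le_iff_subset M.nodup).2 fun G hG =>
      Multiset.mem_toFinset.1 (Finset.mem_filter.1 hG).1
    have hmin : ∀ G ∈ M, ∀ H ∈ F, H ⊆ G → H = G := fun G hG => (Finset.mem_filter.1 hG).2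
    have hbelow : ∀ G ∈ F, ∃ H ∈ M, H ⊆ G := by
      intro G hG
      obtain ⟨H, hH, hHmin⟩ := (F.toFinset.filter (· ⊆ G)).exists_min_image Finset.card
        ⟨G, by simp [hG]⟩
      simp only [Finset.mem_filter, Multiset.mem_toFinset] at hH hHmin
      refine ⟨H, ?_, hH.2⟩
      simp only [hM, Finset.mem_filter, Multiset.mem_toFinset]
      exact ⟨hH.1, fun H' hH' hs =>
        Finset.eq_of_subset_of_card_le hs (hHmin H' ⟨hH', hs.trans hH.2⟩)⟩
    clear_value M
    clear hM
    obtain ⟨F', rfl⟩ := Multiset.le_iff_exists_add.1 hMF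
    have hMne : ∀ G ∈ M, G ∈ M.val + F' := fun G hG => Multiset.mem_add.2 (Or.inl hG)
    set S : Finset L := Finset.univ.filter fun c => ∃ G ∈ M, ∃ i, col i = c ∧ Sum.inr i ∉ G with hS
    have hMS : ∀ G ∈ M, ∀ i, Sum.inr i ∉ G → col i ∈ S := fun G hG i hi => by
      simp only [hS, Finset.mem_filter, Finset.mem_univ, true_and]
      exact ⟨G, hG, i, rfl, hi⟩
    have hMsum := hdisj M S (fun G hG => hF G (hMne G hG)) (fun G hG H hH hv => by
      rcases hcomp G (hMne G hG) H (hMne H hH) hv with h | h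
      · exact hmin H hH G (hMne G hG) h
      · exact (hmin G hG H (hMne H hH) h).symm) hMS
    have hpos : ∀ c ∈ S, 1 ≤ z c := by
      intro c hc
      obtain ⟨G, hG, i, rfl, hi⟩ := (Finset.mem_filter.1 hc).2
      obtain ⟨v, hv⟩ := hF G (hMne G hG)
      exact (Multiset.countP_pos.2 ⟨G, hMne G hG, hv, hi⟩).trans_le (hz i v)
    -- Among the members of `F'` separating `(v, i)`, the smallest, `G`, lies in all the others, by
    -- comparability. A minimal `H ⊆ G` also omits `i`, so for `u ∈ H` the same members, and also
    -- `H` itself in `M`, separate `(u, i)`: one unit of `z` is left over.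
    have hz' : ∀ i v, F'.countP (fun G => Sum.inl v ∈ G ∧ Sum.inr i ∉ G) ≤
        z (col i) - if col i ∈ S then 1 else 0 := by
      intro i v
      rcases Nat.eq_zero_or_pos (F'.countP fun G => Sum.inl v ∈ G ∧ Sum.inr i ∉ G) with h0 | h0
      · omega
      obtain ⟨G₁, hG₁, hv₁, hi₁⟩ := Multiset.countP_pos.1 h0
      obtain ⟨G, hG, hGmin⟩ := (F'.toFinset.filter
        fun G => Sum.inl v ∈ G ∧ Sum.inr i ∉ G).exists_min_image Finset.card ⟨G₁, by simp [*]⟩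
      simp only [Finset.mem_filter, Multiset.mem_toFinset] at hG hGmin
      have hGF : G ∈ M.val + F' := Multiset.mem_add.2 (Or.inr hG.1)
      obtain ⟨H, hH, hHG⟩ := hbelow G hGF
      obtain ⟨u, hu⟩ := hF H (hMne H hH)
      have hiH : Sum.inr i ∉ H := fun h => hG.2.2 (hHG h)
      have hle : F'.countP (fun G => Sum.inl v ∈ G ∧ Sum.inr i ∉ G) ≤
          F'.countP (fun G => Sum.inl u ∈ G ∧ Sum.inr i ∉ G) := by
        rw [Multiset.countP_eq_card_filter, Multiset.countP_eq_card_filter]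
        refine Multiset.card_le_card (Multiset.le_filter.2 ⟨Multiset.filter_le _ _, ?_⟩)
        intro X hX
        obtain ⟨hXF, hvX, hiX⟩ := Multiset.mem_filter.1 hX
        refine ⟨?_, hiX⟩
        rcases hcomp G hGF X (Multiset.mem_add.2 (Or.inr hXF)) ⟨v, hG.2.1, hvX⟩ with h | h
        · exact h (hHG hu)
        · rw [Finset.eq_of_subset_of_card_le h (hGmin X ⟨hXF, hvX, hiX⟩)]
          exact hHG hu
      have hM1 : 1 ≤ M.val.countP (fun G => Sum.inl u ∈ G ∧ Sum.inr i ∉ G) :=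
        Multiset.countP_pos.2 ⟨H, hH, hu, hiH⟩
      have := hz i u
      rw [Multiset.countP_add] at this
      split_ifs <;> omega
    have key := ih _ ?_ F' (fun G hG => hF G (Multiset.mem_add.2 (Or.inr hG)))
      (fun c => z c - if c ∈ S then 1 else 0) hz' rfl
    · have hsum : ∑ c, (z c : ℤ) * b c =
          ∑ c, ((z c - if c ∈ S then 1 else 0 : ℕ) : ℤ) * b c + ∑ c ∈ S, b c := by
        have : ∑ c ∈ S, b c = ∑ c, if c ∈ S then b c else 0 := by simp
        rw [this, ← Finset.sum_add_distrib]
        refine Finset.sum_congr rfl fun c _ => ?_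
        split_ifs with h
        · rw [Nat.cast_sub (hpos c h)]
          push_cast
          ring
        · simp
      rw [Multiset.map_add, Multiset.sum_add]
      have : (M.val.map p).sum = ∑ G ∈ M, p G := rfl
      linarith
    · obtain ⟨H, hH, -⟩ := hbelow G₀ hG₀
      rw [Multiset.map_add, Multiset.sum_add] at hm
      have : 0 < (M.val.map fun G => N ^ 2 + 1 - G.card ^ 2).sum := by
        change 0 < ∑ G ∈ M, (N ^ 2 + 1 - G.card ^ 2)
        exact Finset.sum_pos (fun G _ => by have := hcard G; omega) ⟨H, hH⟩
      omega

end Uncrossing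

/-! ### Extending the root sets within the budgets. -/

section RootSets

variable {V : Type*} [DecidableEq V] {k l : ℕ}

/-- Index sets are united where vertex sets are intersected, and conversely. Hence a pair `(X, J)`
is encoded below as the disjoint sum of `X` and `Jᶜ`, which turns this into ordinary
supermodularity. -/
theorem card_missedBy_add_le (U : Fin k → Finset V) (I J : Finset (Fin k)) (X Y : Finset V) :
    (missedBy U I X).card + (missedBy U J Y).card ≤
      (missedBy U (I ∪ J) (X ∩ Y)).card + (missedBy U (I ∩ J) (X ∪ Y)).card := by
  have h₁ : missedBy U I X ∪ missedBy U J Y ⊆ missedBy U (I ∪ J) (X ∩ Y) := by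
    intro i hi
    simp only [missedBy, Finset.mem_union, Finset.mem_filter, Finset.ext_iff, Finset.mem_inter,
      Finset.notMem_empty, iff_false] at hi ⊢
    grind
  have h₂ : missedBy U I X ∩ missedBy U J Y ⊆ missedBy U (I ∩ J) (X ∪ Y) := by
    intro i hi
    simp only [missedBy, Finset.mem_union, Finset.mem_filter, Finset.ext_iff, Finset.mem_inter,
      Finset.notMem_empty, iff_false] at hi ⊢
    grind
  have := Finset.card_le_card h₁
  have := Finset.card_le_card h₂
  have := Finset.card_union_add_card_inter (missedBy U I X) (missedBy U J Y)
  omega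

theorem missedBy_anti {U R : Fin k → Finset V} (h : U ≤ R) (J : Finset (Fin k)) (X : Finset V) :
    missedBy R J X ⊆ missedBy U J X := by
  intro i hi
  simp only [missedBy, Finset.mem_filter] at hi ⊢
  refine ⟨hi.1, ?_⟩
  rw [← Finset.subset_empty, ← hi.2]
  exact Finset.inter_subset_inter_left (h i)

/-- The necessary condition for root sets `R` to be extended by at most
`c α - ∑ i ∈ I α, |R i|` roots in each block, with finite families in place of sequences. -/
def PackingCondition (d : Finset V → ℕ) (I : Fin l → Finset (Fin k)) (c : Fin l → ℕ)
    (R : Fin k → Finset V) : Prop :=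
  ∀ M : Finset (Finset V), (∀ X ∈ M, X.Nonempty) → (∀ X ∈ M, ∀ Y ∈ M, X ≠ Y → Disjoint X Y) →
    ∀ S : Finset (Fin l),
      ∑ X ∈ M, (((missedBy R (S.biUnion I) X).card : ℤ) - (d X : ℤ)) ≤
        ∑ α ∈ S, ((c α : ℤ) - ∑ i ∈ I α, ((R i).card : ℤ))

theorem sum_le_of_packingCondition [Fintype V] {d : Finset V → ℕ}
    (hd : ∀ X Y, d (X ∩ Y) + d (X ∪ Y) ≤ d X + d Y)
    {I : Fin l → Finset (Fin k)} {col : Fin k → Fin l} (hcol : ∀ α i, i ∈ I α ↔ col i = α)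
    {c : Fin l → ℕ} {R : Fin k → Finset V} (hR : PackingCondition d I c R)
    (hc : ∀ α, ∑ i ∈ I α, (R i).card ≤ c α)
    (F : Multiset (Finset (V ⊕ Fin k))) (hF : ∀ G ∈ F, ∃ v, Sum.inl v ∈ G) (z : Fin l → ℕ)
    (hz : ∀ i v, F.countP (fun G => Sum.inl v ∈ G ∧ Sum.inr i ∉ G) ≤ z (col i)) :
    (F.map fun G => ((missedBy R (G.toRight)ᶜ G.toLeft).card : ℤ) - (d G.toLeft : ℤ)).sum ≤
      ∑ α, (z α : ℤ) * ((c α : ℤ) - ∑ i ∈ I α, ((R i).card : ℤ)) := by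
  refine sum_le_of_separation_le _ ?_ col _ ?_ ?_ F hF z hz
  · intro G H _
    have h₁ := hd G.toLeft H.toLeft
    have h₂ := card_missedBy_add_le R (G.toRight)ᶜ (H.toRight)ᶜ G.toLeft H.toLeft
    rw [← Finset.compl_inter, ← Finset.compl_union] at h₂
    rw [Finset.toLeft_inter, Finset.toLeft_union, Finset.toRight_inter, Finset.toRight_union]
    omega
  · intro α
    have := hc α
    rw [sub_nonneg]
    exact_mod_cast this
  · intro M S hne hdis hS
    have hinj : Set.InjOn (Finset.toLeft : Finset (V ⊕ Fin k) → Finset V) M := by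
      intro G hG H hH e
      obtain ⟨v, hv⟩ := hne G hG
      refine hdis G hG H hH ⟨v, hv, ?_⟩
      rw [← Finset.mem_toLeft] at hv ⊢
      exact e ▸ hv
    have key := hR (M.image Finset.toLeft) ?_ ?_ S
    · rw [Finset.sum_image hinj] at key
      refine le_trans (Finset.sum_le_sum fun G hG => ?_) key
      have : missedBy R (G.toRight)ᶜ G.toLeft ⊆ missedBy R (S.biUnion I) G.toLeft := by
        refine Finset.filter_subset_filter _ fun i hi => ?_
        rw [Finset.mem_compl, Finset.mem_toRight] at hi
        exact Finset.mem_biUnion.2 ⟨col i, hS G hG i hi, (hcol _ _).2 rfl⟩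
      have := Finset.card_le_card this
      omega
    · intro X hX
      obtain ⟨G, hG, rfl⟩ := Finset.mem_image.1 hX
      obtain ⟨v, hv⟩ := hne G hG
      exact ⟨v, Finset.mem_toLeft.2 hv⟩
    · intro X hX Y hY hXY
      obtain ⟨G, hG, rfl⟩ := Finset.mem_image.1 hX
      obtain ⟨H, hH, rfl⟩ := Finset.mem_image.1 hY
      refine Finset.disjoint_left.2 fun v hv hv' => hXY ?_
      rw [hdis G hG H hH ⟨v, Finset.mem_toLeft.1 hv, Finset.mem_toLeft.1 hv'⟩]

theorem sum_card_update_insert {I : Fin l → Finset (Fin k)} {col : Fin k → Fin l}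
    (hcol : ∀ α i, i ∈ I α ↔ col i = α) {R : Fin k → Finset V} {i : Fin k} {v : V}
    (hv : v ∉ R i) (α : Fin l) :
    ∑ j ∈ I α, (Function.update R i (insert v (R i)) j).card =
      ∑ j ∈ I α, (R j).card + if col i = α then 1 else 0 := by
  have h : ∀ j, (Function.update R i (insert v (R i)) j).card =
      (R j).card + if j = i then 1 else 0 := by
    intro j
    by_cases hj : j = i
    · subst hj
      simp [hv]
    · simp [hj]
  simp only [h, Finset.sum_add_distrib, Finset.sum_ite_eq', hcol]

/-- If a block has a root left to place and somewhere to place it, one can place it so that the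
packing condition is kept. -/
theorem PackingCondition.exists_insert [Fintype V] {d : Finset V → ℕ}
    (hd : ∀ X Y, d (X ∩ Y) + d (X ∪ Y) ≤ d X + d Y)
    {I : Fin l → Finset (Fin k)} {col : Fin k → Fin l} (hcol : ∀ α i, i ∈ I α ↔ col i = α)
    {c : Fin l → ℕ} {R : Fin k → Finset V} (hR : PackingCondition d I c R)
    (hc : ∀ α, ∑ i ∈ I α, (R i).card ≤ c α) {α : Fin l} (hα : ∑ i ∈ I α, (R i).card < c α)
    (hex : ∃ i ∈ I α, R i ≠ Finset.univ) :
    ∃ i ∈ I α, ∃ v ∉ R i, PackingCondition d I c (Function.update R i (insert v (R i))) := by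
  by_contra! hno
  set T : Finset (Fin k × V) := Finset.univ.filter fun e => e.1 ∈ I α ∧ e.2 ∉ R e.1 with hT
  have hTmem : ∀ e, e ∈ T ↔ e.1 ∈ I α ∧ e.2 ∉ R e.1 := by simp [hT]
  have hTne : T.Nonempty := by
    obtain ⟨i, hi, hne⟩ := hex
    obtain ⟨v, hv⟩ : ∃ v, v ∉ R i := by
      by_contra! h
      exact hne (Finset.eq_univ_iff_forall.2 h)
    exact ⟨(i, v), (hTmem _).2 ⟨hi, hv⟩⟩
  set Q : Fin k × V → Fin k → Finset V := fun e => Function.update R e.1 (insert e.2 (R e.1))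
    with hQ
  have hRQ : ∀ e, R ≤ Q e := by
    intro e j
    by_cases hj : j = e.1
    · subst hj
      simp [hQ]
    · simp [hQ, hj]
  have hQmem : ∀ e : Fin k × V, e.2 ∈ Q e e.1 := fun e => by simp [hQ]
  have hviol : ∀ e : Fin k × V, ∃ (M : Finset (Finset V)) (S : Finset (Fin l)), e ∈ T →
      (∀ X ∈ M, X.Nonempty) ∧ (∀ X ∈ M, ∀ Y ∈ M, X ≠ Y → Disjoint X Y) ∧
      ∑ β ∈ S, ((c β : ℤ) - ∑ i ∈ I β, ((Q e i).card : ℤ)) <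
        ∑ X ∈ M, (((missedBy (Q e) (S.biUnion I) X).card : ℤ) - (d X : ℤ)) := by
    intro e
    by_cases he : e ∈ T
    · have := hno e.1 ((hTmem e).1 he).1 e.2 ((hTmem e).1 he).2
      simp only [PackingCondition] at this
      push Not at this
      obtain ⟨M, h₁, h₂, S, h₃⟩ := this
      exact ⟨M, S, fun _ => ⟨h₁, h₂, h₃⟩⟩
    · exact ⟨∅, ∅, fun h => absurd h he⟩
  choose M S hMS using hviol
  set b : Fin l → ℤ := fun β => (c β : ℤ) - ∑ i ∈ I β, ((R i).card : ℤ) with hb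
  have hbQ : ∀ e ∈ T, ∑ β ∈ S e, ((c β : ℤ) - ∑ i ∈ I β, ((Q e i).card : ℤ)) =
      ∑ β ∈ S e, b β - if α ∈ S e then 1 else 0 := by
    intro e he
    have hce : col e.1 = α := (hcol _ _).1 ((hTmem e).1 he).1
    have : ∀ β, (c β : ℤ) - ∑ i ∈ I β, ((Q e i).card : ℤ) = b β - if α = β then 1 else 0 := by
      intro β
      have := sum_card_update_insert hcol ((hTmem e).1 he).2 β
      rw [hce] at this
      have h' : ∑ i ∈ I β, ((Q e i).card : ℤ) =
          ∑ i ∈ I β, ((R i).card : ℤ) + if α = β then 1 else 0 := by exact_mod_cast this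
      rw [h', hb]
      ring
    simp only [this, Finset.sum_sub_distrib, Finset.sum_ite_eq]
  -- The insertion lowers the right side by 1 exactly when `α ∈ S e` and cannot raise the left side.
  -- As `R` meets the condition, a violation needs `α ∈ S e` and, by integrality, fails by less than
  -- one unit of the old budget.
  have hle : ∀ e ∈ T, α ∈ S e ∧ ∑ β ∈ S e, b β ≤
      ∑ X ∈ M e, (((missedBy (Q e) ((S e).biUnion I) X).card : ℤ) - (d X : ℤ)) := by
    intro e he
    obtain ⟨h₁, h₂, h₃⟩ := hMS e he
    rw [hbQ e he] at h₃
    have h₄ := hR (M e) h₁ h₂ (S e)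
    have h₅ : ∑ X ∈ M e, (((missedBy (Q e) ((S e).biUnion I) X).card : ℤ) - (d X : ℤ)) ≤
        ∑ X ∈ M e, (((missedBy R ((S e).biUnion I) X).card : ℤ) - (d X : ℤ)) := by
      refine Finset.sum_le_sum fun X _ => ?_
      have := Finset.card_le_card (missedBy_anti (hRQ e) ((S e).biUnion I) X)
      omega
    by_cases hαS : α ∈ S e
    · rw [if_pos hαS] at h₃
      exact ⟨hαS, by omega⟩
    · rw [if_neg hαS] at h₃
      change _ ≤ ∑ β ∈ S e, b β at h₄
      omega
  set G : Fin k × V → Finset V → Finset (V ⊕ Fin k) := fun e X =>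
    X.disjSum (missedBy (Q e) ((S e).biUnion I) X)ᶜ with hG
  -- For an index `i` in block `α` and `v ∉ R i`, the family of the insertion `(i, v)` never
  -- separates `(v, i)`, which saves one out of `T.card`. If `v ∈ R i`, no family separates the
  -- pair.
  set z : Fin l → ℕ := fun β =>
    if β = α then T.card - 1 else (T.filter fun e => β ∈ S e).card with hzdef
  have hGmem : ∀ e X v i, (Sum.inl v ∈ G e X ∧ Sum.inr i ∉ G e X) ↔
      (v ∈ X ∧ i ∈ missedBy (Q e) ((S e).biUnion I) X) := by
    intro e X v i
    simp [hG]
  have hcount : ∀ e ∈ T, ∀ i v,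
      ((M e).val.map (G e)).countP (fun G => Sum.inl v ∈ G ∧ Sum.inr i ∉ G) ≤
        if col i ∈ S e ∧ v ∉ Q e i then 1 else 0 := by
    intro e he i v
    obtain ⟨-, h₂, -⟩ := hMS e he
    rw [Multiset.countP_map]
    simp only [hGmem]
    change ((M e).filter fun X => v ∈ X ∧ i ∈ missedBy (Q e) ((S e).biUnion I) X).card ≤ _
    split_ifs with h
    · refine Finset.card_le_one.2 fun X hX Y hY => ?_
      rw [Finset.mem_filter] at hX hY
      by_contra hXY
      exact Finset.disjoint_left.1 (h₂ X hX.1 Y hY.1 hXY) hX.2.1 hY.2.1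
    · rw [Nat.le_zero, Finset.card_eq_zero, Finset.filter_eq_empty_iff]
      rintro X hX ⟨hvX, hi⟩
      rw [missedBy, Finset.mem_filter, Finset.mem_biUnion] at hi
      obtain ⟨⟨β, hβ, hiβ⟩, hXQ⟩ := hi
      refine h ⟨(hcol _ _).1 hiβ ▸ hβ, fun hvQ => ?_⟩
      exact Finset.notMem_empty v (hXQ ▸ Finset.mem_inter.2 ⟨hvX, hvQ⟩)
  have key := sum_le_of_packingCondition hd hcol hR hc (∑ e ∈ T, (M e).val.map (G e)) ?_ z ?_
  · have h₁ : ∑ e ∈ T, ∑ β ∈ S e, b β ≤ ((∑ e ∈ T, (M e).val.map (G e)).map fun G =>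
        ((missedBy R (G.toRight)ᶜ G.toLeft).card : ℤ) - (d G.toLeft : ℤ)).sum := by
      have hsum : ∀ g : Finset (V ⊕ Fin k) → ℤ, ((∑ e ∈ T, (M e).val.map (G e)).map g).sum =
          ∑ e ∈ T, (((M e).val.map (G e)).map g).sum := fun g =>
        map_sum (Multiset.sumAddMonoidHom.comp (Multiset.mapAddMonoidHom g)) _ _
      rw [hsum]
      refine Finset.sum_le_sum fun e he => (hle e he).2.trans ?_
      rw [Multiset.map_map]
      refine Finset.sum_le_sum fun X _ => ?_
      have hsub : missedBy (Q e) ((S e).biUnion I) X ⊆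
          missedBy R (missedBy (Q e) ((S e).biUnion I) X) X := by
        intro i hi
        have := missedBy_anti (hRQ e) _ _ hi
        exact Finset.mem_filter.2 ⟨hi, (Finset.mem_filter.1 this).2⟩
      have := Finset.card_le_card hsub
      simp only [hG, Function.comp, Finset.toLeft_disjSum, Finset.toRight_disjSum, compl_compl]
      omega
    have h₂ : ∑ e ∈ T, ∑ β ∈ S e, b β = ∑ β, (z β : ℤ) * b β + b α := by
      have : ∀ e ∈ T, ∑ β ∈ S e, b β = ∑ β, if β ∈ S e then b β else 0 := by simp
      rw [Finset.sum_congr rfl this, Finset.sum_comm,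
        ← Finset.add_sum_erase _ _ (Finset.mem_univ α),
        ← Finset.add_sum_erase (f := fun β => (z β : ℤ) * b β) _ (Finset.mem_univ α)]
      have h₃ : ∑ e ∈ T, (if α ∈ S e then b α else 0) = (z α : ℤ) * b α + b α := by
        rw [Finset.sum_congr rfl fun e he => if_pos (hle e he).1, Finset.sum_const, hzdef]
        simp only [if_true, nsmul_eq_mul]
        have := hTne.card_pos
        rw [Nat.cast_sub this]
        push_cast
        ring
      have h₄ : ∑ β ∈ Finset.univ.erase α, ∑ e ∈ T, (if β ∈ S e then b β else 0) =
          ∑ β ∈ Finset.univ.erase α, (z β : ℤ) * b β := by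
        refine Finset.sum_congr rfl fun β hβ => ?_
        rw [← Finset.sum_filter, Finset.sum_const, hzdef]
        simp only [if_neg (Finset.ne_of_mem_erase hβ), nsmul_eq_mul]
      rw [h₃, h₄]
      ring
    have h₃ : 0 < b α := by
      rw [hb, sub_pos]
      exact_mod_cast hα
    change _ ≤ ∑ β, (z β : ℤ) * b β at key
    omega
  · intro H hH
    rw [Multiset.mem_sum] at hH
    obtain ⟨e, he, hH⟩ := hH
    obtain ⟨X, hX, rfl⟩ := Multiset.mem_map.1 hH
    obtain ⟨v, hv⟩ := (hMS e he).1 X hX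
    exact ⟨v, by simpa [hG] using hv⟩
  · intro i v
    have hsum : (∑ e ∈ T, (M e).val.map (G e)).countP (fun G => Sum.inl v ∈ G ∧ Sum.inr i ∉ G) =
        ∑ e ∈ T, ((M e).val.map (G e)).countP (fun G => Sum.inl v ∈ G ∧ Sum.inr i ∉ G) :=
      map_sum (Multiset.countPAddMonoidHom
        fun G : Finset (V ⊕ Fin k) => Sum.inl v ∈ G ∧ Sum.inr i ∉ G) _ _
    rw [hsum]
    refine (Finset.sum_le_sum fun e he => hcount e he i v).trans ?_
    rw [← Finset.sum_filter, Finset.sum_const, smul_eq_mul, mul_one, hzdef]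
    simp only
    split_ifs with hi
    · by_cases hiv : (i, v) ∈ T
      · rw [← Finset.card_erase_of_mem hiv]
        refine Finset.card_le_card fun e he => ?_
        rw [Finset.mem_filter] at he
        refine Finset.mem_erase.2 ⟨?_, he.1⟩
        rintro rfl
        exact he.2.2 (hQmem _)
      · rw [hTmem] at hiv
        have hvR : v ∈ R i := by
          by_contra h
          exact hiv ⟨(hcol _ _).2 hi, h⟩
        rw [Finset.filter_eq_empty_iff.2 fun e _ h => h.2 (hRQ e i hvR), Finset.card_empty]
        exact Nat.zero_le _
    · refine Finset.card_le_card fun e he => ?_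
      rw [Finset.mem_filter] at he ⊢
      exact ⟨he.1, he.2.1⟩

/-- An `R` of maximal total size works: a block with budget left is full, so none of its indices
misses a nonempty `X`, and the blocks with no budget left contribute 0 to the right side of the
condition for `{X}`. -/
theorem PackingCondition.exists_roots [Fintype V] {d : Finset V → ℕ}
    (hd : ∀ X Y, d (X ∩ Y) + d (X ∪ Y) ≤ d X + d Y)
    {I : Fin l → Finset (Fin k)} {col : Fin k → Fin l} (hcol : ∀ α i, i ∈ I α ↔ col i = α)
    {c : Fin l → ℕ} {U : Fin k → Finset V} (hU : PackingCondition d I c U)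
    (hc : ∀ α, ∑ i ∈ I α, (U i).card ≤ c α) :
    ∃ R : Fin k → Finset V, U ≤ R ∧ (∀ α, ∑ i ∈ I α, (R i).card ≤ c α) ∧
      ∀ X : Finset V, X.Nonempty → (missedBy R Finset.univ X).card ≤ d X := by
  obtain ⟨R, ⟨hUR, hcR, hR⟩, hmax⟩ := Set.exists_max_image
    {R : Fin k → Finset V | U ≤ R ∧ (∀ α, ∑ i ∈ I α, (R i).card ≤ c α) ∧ PackingCondition d I c R}
    (fun R => ∑ i, (R i).card) (Set.toFinite _) ⟨U, le_rfl, hc, hU⟩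
  refine ⟨R, hUR, hcR, fun X hX => ?_⟩
  have hfull : ∀ α, ∑ i ∈ I α, (R i).card < c α → ∀ i ∈ I α, R i = Finset.univ := by
    intro α hα
    by_contra! hex
    obtain ⟨i, hi, v, hv, hQ⟩ := hR.exists_insert hd hcol hcR hα hex
    have hsum := sum_card_update_insert hcol hv
    have hlt : ∑ j, (R j).card < ∑ j, (Function.update R i (insert v (R i)) j).card := by
      refine Finset.sum_lt_sum (fun j _ => ?_) ⟨i, Finset.mem_univ _, by simp [hv]⟩
      by_cases hj : j = i
      · subst hj
        simp [hv]
      · simp [hj]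
    refine absurd (hmax _ ⟨?_, ?_, hQ⟩) (not_le.2 hlt)
    · intro j
      by_cases hj : j = i
      · subst hj
        simpa using (hUR j).trans (Finset.subset_insert v (R j))
      · simpa [hj] using hUR j
    · intro β
      rw [hsum]
      split_ifs with h
      · rw [← h, (hcol _ _).1 hi]
        exact hα
      · exact hcR β
  set S : Finset (Fin l) := Finset.univ.filter fun α => ∑ i ∈ I α, (R i).card = c α with hS
  have key := hR {X} (by simpa using hX) (by simp) S
  rw [Finset.sum_singleton, Finset.sum_eq_zero (s := S) (fun α hα => by
    rw [sub_eq_zero]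
    exact_mod_cast (Finset.mem_filter.1 hα).2.symm)] at key
  have hsub : missedBy R Finset.univ X ⊆ missedBy R (S.biUnion I) X := by
    intro i hi
    have hi' := (Finset.mem_filter.1 hi).2
    refine Finset.mem_filter.2 ⟨Finset.mem_biUnion.2 ⟨col i, ?_, (hcol _ _).2 rfl⟩, hi'⟩
    refine Finset.mem_filter.2 ⟨Finset.mem_univ _, ?_⟩
    by_contra hne
    rw [hfull _ (lt_of_le_of_ne (hcR _) hne) i ((hcol _ _).2 rfl), Finset.inter_univ] at hi'
    exact hX.ne_empty hi'
  have := Finset.card_le_card hsub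
  omega

end RootSets

/-! ### Edmonds' theorem by Lovász's augmentation. -/

namespace MultiDigraph

section Packing

variable {V A : Type*} [DecidableEq V] [DecidableEq A] (D : MultiDigraph V A)

/-- The arcs of `E` with tail outside `X` and head in `X`. -/
def entering (E : Finset A) (X : Finset V) : Finset A :=
  E.filter fun a => D.tail a ∉ X ∧ D.head a ∈ X

theorem card_entering_inter_add_union_le (E : Finset A) (X Y : Finset V) :
    (D.entering E (X ∩ Y)).card + (D.entering E (X ∪ Y)).card ≤
      (D.entering E X).card + (D.entering E Y).card := by
  have h₁ : D.entering E (X ∩ Y) ∪ D.entering E (X ∪ Y) ⊆ D.entering E X ∪ D.entering E Y := by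
    intro a ha
    simp only [entering, Finset.mem_union, Finset.mem_filter, Finset.mem_inter] at ha ⊢
    tauto
  have h₂ : D.entering E (X ∩ Y) ∩ D.entering E (X ∪ Y) ⊆ D.entering E X ∩ D.entering E Y := by
    intro a ha
    simp only [entering, Finset.mem_union, Finset.mem_filter, Finset.mem_inter] at ha ⊢
    tauto
  have := Finset.card_le_card h₁
  have := Finset.card_le_card h₂
  have := Finset.card_union_add_card_inter (D.entering E X) (D.entering E Y)
  have := Finset.card_union_add_card_inter (D.entering E (X ∩ Y)) (D.entering E (X ∪ Y))
  omega

/-- `D.Spans W F`: the arcs of `F` can be ordered so that, starting from the vertex set `W`, each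
of them leads from a vertex reached to a new one, and all vertices are reached. -/
inductive Spans [Fintype V] : Finset V → Finset A → Prop
  | univ : Spans Finset.univ ∅
  | step (a : A) (W : Finset V) (F : Finset A) (ht : D.tail a ∈ W) (hh : D.head a ∉ W)
      (hF : Spans (insert (D.head a) W) F) : Spans W (insert a F)

variable {D} {k : ℕ}

theorem mem_missedBy_univ {W : Fin k → Finset V} {X : Finset V} {i : Fin k} :
    i ∈ missedBy W Finset.univ X ↔ ∀ v ∈ X, v ∉ W i := by
  simp [missedBy, Finset.eq_empty_iff_forall_notMem]

/-- The augmentation step in Lovász's proof of Edmonds' disjoint branchings theorem. -/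
theorem exists_augmenting_arc [Fintype V] {W : Fin k → Finset V} {E : Finset A}
    (h : ∀ X : Finset V, X.Nonempty →
      (missedBy W Finset.univ X).card ≤ (D.entering E X).card)
    {i : Fin k} (hi : W i ≠ Finset.univ) :
    ∃ a ∈ E, D.tail a ∈ W i ∧ D.head a ∉ W i ∧ ∀ X : Finset V, X.Nonempty →
      (missedBy (Function.update W i (insert (D.head a) (W i))) Finset.univ X).card ≤
        (D.entering (E.erase a) X).card := by
  have hV : (Finset.univ : Finset V).Nonempty := by
    obtain ⟨v, -⟩ : ∃ v, v ∉ W i := by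
      by_contra! h'
      exact hi (Finset.eq_univ_iff_forall.2 h')
    exact ⟨v, Finset.mem_univ v⟩
  set P : Finset V → Finset (Fin k) := fun X => missedBy W Finset.univ X with hP
  have hmem : ∀ X j, j ∈ P X ↔ ∀ v ∈ X, v ∉ W j := fun X j => mem_missedBy_univ
  -- The tight sets that meet `W i` without lying inside it. The whole vertex set is one, since no
  -- arc enters it.
  set C : Finset (Finset V) := Finset.univ.filter fun X =>
    (P X).card = (D.entering E X).card ∧ i ∉ P X ∧ ∃ v ∈ X, v ∉ W i with hC
  have hCV : Finset.univ ∈ C := by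
    have h0 : D.entering E Finset.univ = ∅ := by simp [entering]
    have h1 : P Finset.univ = ∅ := by
      have := h Finset.univ hV
      rw [h0, Finset.card_empty, Nat.le_zero, Finset.card_eq_zero] at this
      exact this
    simp only [hC, Finset.mem_filter, Finset.mem_univ, true_and, h0, h1, Finset.card_empty,
      Finset.notMem_empty, not_false_eq_true]
    by_contra! h'
    exact hi (Finset.eq_univ_iff_forall.2 h')
  obtain ⟨X, hX, hmin⟩ := C.exists_min_image Finset.card ⟨_, hCV⟩
  simp only [hC, Finset.mem_filter, Finset.mem_univ, true_and] at hX hmin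
  obtain ⟨hXt, hXi, hXout⟩ := hX
  -- Removing `W i` from `X` makes `i` a missed index, so tightness of `X` forces an arc entering `X
  -- \ W i` from inside `X`.
  obtain ⟨a, ha, haX⟩ : ∃ a ∈ D.entering E (X \ W i), a ∉ D.entering E X := by
    by_contra! hsub
    have h₁ := Finset.card_le_card (show D.entering E (X \ W i) ⊆ D.entering E X from hsub)
    have h₂ := h (X \ W i) (by
      obtain ⟨v, hv, hv'⟩ := hXout
      exact ⟨v, Finset.mem_sdiff.2 ⟨hv, hv'⟩⟩)
    have h₃ : insert i (P X) ⊆ P (X \ W i) := by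
      intro j hj
      rw [hmem]
      intro v hv
      rw [Finset.mem_sdiff] at hv
      rcases Finset.mem_insert.1 hj with rfl | hj
      · exact hv.2
      · exact (hmem _ _).1 hj v hv.1
    have h₄ := Finset.card_le_card h₃
    rw [Finset.card_insert_of_notMem hXi] at h₄
    change (P _).card ≤ _ at h₂
    omega
  simp only [entering, Finset.mem_filter, Finset.mem_sdiff, not_and, not_not] at ha haX
  obtain ⟨haE, hta, hhX, hhW⟩ := ha
  have htX : D.tail a ∈ X := by
    by_contra h'
    exact haX haE h' hhX
  refine ⟨a, haE, hta htX, hhW, fun Y hY => ?_⟩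
  set P' := missedBy (Function.update W i (insert (D.head a) (W i))) Finset.univ Y with hP'
  have hPY := h Y hY
  change (P Y).card ≤ _ at hPY
  have hsub : P' ⊆ P Y := by
    refine missedBy_anti (fun j => ?_) _ _
    by_cases hj : j = i
    · subst hj
      simp
    · simp [hj]
  have hcard := Finset.card_le_card hsub
  by_cases haY : a ∈ D.entering E Y
  swap
  · have : D.entering (E.erase a) Y = D.entering E Y := by
      rw [entering, Finset.filter_erase]
      exact Finset.erase_eq_of_notMem haY
    rw [this]
    omega
  have hdec : (D.entering (E.erase a) Y).card + 1 = (D.entering E Y).card := by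
    rw [entering, Finset.filter_erase]
    exact Finset.card_erase_add_one haY
  obtain ⟨-, htY, hhY⟩ := Finset.mem_filter.1 haY
  by_cases hiY : i ∈ P Y
  · have : P' ⊂ P Y := by
      refine ⟨hsub, fun hs => ?_⟩
      have := mem_missedBy_univ.1 (hs hiY) _ hhY
      simp at this
    have := Finset.card_lt_card this
    omega
  by_cases hlt : (P Y).card < (D.entering E Y).card
  · omega
  -- Now `Y` is tight and `i` does not miss it. Uncrossing makes `X ∩ Y` tight with `i` still not
  -- missing it. It contains the head of `a` but not the tail, so it contradicts the minimality of
  -- `X`.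
  exfalso
  have hne : (X ∩ Y).Nonempty := ⟨_, Finset.mem_inter.2 ⟨hhX, hhY⟩⟩
  have h₁ := D.card_entering_inter_add_union_le E X Y
  have h₂ := h (X ∩ Y) hne
  have h₃ := h (X ∪ Y) ⟨_, Finset.mem_union_left _ hhX⟩
  change (P _).card ≤ _ at h₂
  change (P _).card ≤ _ at h₃
  have h₄ : P X ∪ P Y ⊆ P (X ∩ Y) := by
    intro j hj
    rw [hmem]
    intro v hv
    rw [Finset.mem_inter] at hv
    rcases Finset.mem_union.1 hj with hj | hj
    · exact (hmem _ _).1 hj v hv.1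
    · exact (hmem _ _).1 hj v hv.2
  have h₅ : P X ∩ P Y ⊆ P (X ∪ Y) := by
    intro j hj
    rw [Finset.mem_inter] at hj
    rw [hmem]
    intro v hv
    rcases Finset.mem_union.1 hv with hv | hv
    · exact (hmem _ _).1 hj.1 v hv
    · exact (hmem _ _).1 hj.2 v hv
  have h₆ := Finset.card_le_card h₄
  have h₇ := Finset.card_le_card h₅
  have h₈ := Finset.card_union_add_card_inter (P X) (P Y)
  have heq : P X ∪ P Y = P (X ∩ Y) := Finset.eq_of_subset_of_card_le h₄ (by omega)
  have hle := hmin (X ∩ Y) ⟨by omega, by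
    rw [← heq, Finset.mem_union]
    tauto, _, Finset.mem_inter.2 ⟨hhX, hhY⟩, hhW⟩
  have : (X ∩ Y).card < X.card := Finset.card_lt_card
    ⟨Finset.inter_subset_left, fun hs => htY (Finset.mem_inter.1 (hs htX)).2⟩
  omega

/-- Edmonds' disjoint branchings theorem. -/
theorem exists_disjoint_spans [Fintype V] {W : Fin k → Finset V} {E : Finset A}
    (h : ∀ X : Finset V, X.Nonempty →
      (missedBy W Finset.univ X).card ≤ (D.entering E X).card) :
    ∃ F : Fin k → Finset A, (∀ i, F i ⊆ E) ∧ (∀ i j, i ≠ j → Disjoint (F i) (F j)) ∧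
      ∀ i, D.Spans (W i) (F i) := by
  induction hm : ∑ i, (W i)ᶜ.card using Nat.strong_induction_on generalizing W E with
  | _ n ih =>
  by_cases hall : ∀ i, W i = Finset.univ
  · exact ⟨fun _ => ∅, fun _ => Finset.empty_subset _, fun _ _ _ => Finset.disjoint_empty_left _,
      fun i => hall i ▸ Spans.univ⟩
  push Not at hall
  obtain ⟨i, hi⟩ := hall
  obtain ⟨a, haE, hta, hha, hstep⟩ := exists_augmenting_arc h hi
  obtain ⟨F, hFE, hdis, hF⟩ := ih _ (by
    rw [← hm]
    refine Finset.sum_lt_sum (fun j _ => ?_) ⟨i, Finset.mem_univ _, ?_⟩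
    · by_cases hj : j = i
      · subst hj
        simp only [Function.update_self]
        exact Finset.card_le_card (Finset.compl_subset_compl.2 (Finset.subset_insert _ _))
      · simp [hj]
    · simp only [Function.update_self]
      refine Finset.card_lt_card ⟨Finset.compl_subset_compl.2 (Finset.subset_insert _ _), ?_⟩
      intro hs
      have := hs (Finset.mem_compl.2 hha)
      simp at this) hstep rfl
  have haF : ∀ j, a ∉ F j := fun j hj => Finset.notMem_erase a E (hFE j hj)
  refine ⟨Function.update F i (insert a (F i)), fun j => ?_, fun j j' hjj => ?_, fun j => ?_⟩
  · by_cases hj : j = i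
    · subst hj
      rw [Function.update_self]
      exact Finset.insert_subset haE ((hFE j).trans (Finset.erase_subset _ _))
    · rw [Function.update_of_ne hj]
      exact (hFE j).trans (Finset.erase_subset _ _)
  · by_cases hj : j = i
    · subst hj
      rw [Function.update_self, Function.update_of_ne hjj.symm, Finset.disjoint_insert_left]
      exact ⟨haF _, hdis _ _ hjj⟩
    · by_cases hj' : j' = i
      · subst hj'
        rw [Function.update_self, Function.update_of_ne hjj, Finset.disjoint_insert_right]
        exact ⟨haF _, hdis _ _ hjj⟩
      · rw [Function.update_of_ne hj, Function.update_of_ne hj']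
        exact hdis _ _ hjj
  · have := hF j
    by_cases hj : j = i
    · subst hj
      rw [Function.update_self] at this ⊢
      exact Spans.step a _ _ hta hha this
    · rwa [Function.update_of_ne hj] at this ⊢

end Packing

end MultiDigraph

/-! ### From arc sets to branchings and their roots. -/

namespace MultiDigraph

variable {V A : Type*} {D : MultiDigraph V A}

namespace Subdigraph

theorem isDirWalk_concat {F : D.Subdigraph} {u v : V} {p : List A} {a : A} :
    F.IsDirWalk u (p ++ [a]) v ↔ F.IsDirWalk u p (D.tail a) ∧ a ∈ F.arcs ∧ D.head a = v := by
  induction p generalizing u with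
  | nil =>
    simp only [List.nil_append, IsDirWalk]
    constructor
    · rintro ⟨ha, rfl, -, rfl⟩
      exact ⟨⟨F.tail_mem a ha, rfl⟩, ha, rfl⟩
    · rintro ⟨⟨-, rfl⟩, ha, rfl⟩
      exact ⟨ha, rfl, F.head_mem a ha, rfl⟩
  | cons b p ih =>
    simp only [List.cons_append, IsDirWalk, ih]
    tauto

/-- The vertices of a directed walk increase along a function that increases along arcs. -/
theorem IsDirWalk.pairwise_lt {F : D.Subdigraph} {h : V → ℕ}
    (hlt : ∀ a ∈ F.arcs, h (D.tail a) < h (D.head a)) {u v : V} {p : List A}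
    (hp : F.IsDirWalk u p v) :
    h u ≤ h v ∧ (u :: p.map D.head).Pairwise fun x y => h x < h y := by
  induction p generalizing u with
  | nil => exact ⟨(congrArg h hp.2).le, by simp⟩
  | cons b p ih =>
    obtain ⟨hb, rfl, hp⟩ := hp
    obtain ⟨h₁, h₂⟩ := ih hp
    have hb' := hlt b hb
    refine ⟨hb'.le.trans h₁, ?_⟩
    rw [List.map_cons, List.pairwise_cons]
    refine ⟨fun y hy => ?_, h₂⟩
    rcases List.mem_cons.1 hy with rfl | hy
    · exact hb'
    · exact hb'.trans ((List.pairwise_cons.1 h₂).1 y hy)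

theorem IsDirWalk.isDirPath {F : D.Subdigraph} {h : V → ℕ}
    (hlt : ∀ a ∈ F.arcs, h (D.tail a) < h (D.head a)) {u v : V} {p : List A}
    (hp : F.IsDirWalk u p v) : F.IsDirPath u p v :=
  ⟨hp, (hp.pairwise_lt hlt).2.imp fun hxy => fun e => hxy.ne (congrArg h e)⟩

/-- An acyclic subdigraph in which each vertex except `r` has exactly one entering arc, and `r`
none, is an `r`-arborescence. -/
theorem isArborescence_of_existsUnique [Finite V] {F : D.Subdigraph} {r : V} (hr : r ∈ F.verts)
    {h : V → ℕ} (hlt : ∀ a ∈ F.arcs, h (D.tail a) < h (D.head a))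
    (hroot : ∀ a ∈ F.arcs, D.head a ≠ r)
    (huniq : ∀ v ∈ F.verts, v ≠ r → ∃! a, a ∈ F.arcs ∧ D.head a = v) : F.IsArborescence r := by
  classical
  have hsame : ∀ a ∈ F.arcs, ∀ b ∈ F.arcs, D.head a = D.head b → a = b := fun a ha b hb hab =>
    (huniq _ (F.head_mem a ha) (hroot a ha)).unique ⟨ha, rfl⟩ ⟨hb, hab.symm⟩
  have hwalk : ∀ n, ∀ v ∈ F.verts, h v = n →
      (∃! p, F.IsDirWalk r p v) ∧ ∀ hv : v ∈ F.verts, F.underlying.Reachable ⟨r, hr⟩ ⟨v, hv⟩ := by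
    intro n
    induction n using Nat.strong_induction_on with
    | _ n ih =>
    rintro v hv rfl
    by_cases hvr : v = r
    · subst hvr
      refine ⟨⟨[], ⟨hv, rfl⟩, fun p hp => ?_⟩, fun _ => SimpleGraph.Reachable.refl _⟩
      rcases p.eq_nil_or_concat' with rfl | ⟨q, a, rfl⟩
      · rfl
      · exact absurd (isDirWalk_concat.1 hp).2.2 (hroot a (isDirWalk_concat.1 hp).2.1)
    · obtain ⟨a, ⟨ha, rfl⟩, -⟩ := huniq v hv hvr
      obtain ⟨⟨p, hp, hpu⟩, hreach⟩ := ih _ (hlt a ha) (D.tail a) (F.tail_mem a ha) rfl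
      refine ⟨⟨p ++ [a], isDirWalk_concat.2 ⟨hp, ha, rfl⟩, fun q hq => ?_⟩, fun hv' => ?_⟩
      · rcases q.eq_nil_or_concat' with rfl | ⟨q, b, rfl⟩
        · exact absurd hq.2.symm hvr
        · obtain ⟨hq', hb, hba⟩ := isDirWalk_concat.1 hq
          obtain rfl := hsame b hb a ha hba
          rw [hpu q hq']
      · refine (hreach (F.tail_mem a ha)).trans (SimpleGraph.Adj.reachable ?_)
        exact ⟨a, ha, Or.inl ⟨rfl, rfl⟩⟩
  have hconn : F.underlying.Connected :=
    (SimpleGraph.connected_iff_exists_forall_reachable _).2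
      ⟨⟨r, hr⟩, fun v => (hwalk _ v.1 v.2 rfl).2 v.2⟩
  refine ⟨hr, ⟨SimpleGraph.isTree_iff_connected_and_card.2 ⟨hconn, ?_⟩, ?_⟩, fun u hu => ?_⟩
  · refine le_antisymm ?_ hconn.card_vert_le_card_edgeSet_add_one
    rw [← Nat.card_congr (Equiv.optionSubtypeNe (⟨r, hr⟩ : F.verts)), Finite.card_option]
    refine Nat.succ_le_succ ?_
    -- Sending each non-root vertex to the edge of its entering arc hits every edge, so there are at
    -- most `|V| - 1` edges, with `V` the vertices of `F`.
    have hpar : ∀ v : {v : F.verts // v ≠ ⟨r, hr⟩}, ∃ a, a ∈ F.arcs ∧ D.head a = v.1 := fun v =>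
      (huniq v.1.1 v.1.2 fun e => v.2 (Subtype.ext e)).exists
    choose f hf hfh using hpar
    have hadj : ∀ v, F.underlying.Adj ⟨D.tail (f v), F.tail_mem _ (hf v)⟩ v.1 := fun v =>
      ⟨f v, hf v, Or.inl ⟨rfl, hfh v⟩⟩
    refine Nat.card_le_card_of_surjective
      (fun v => (⟨s(⟨D.tail (f v), F.tail_mem _ (hf v)⟩, v.1), hadj v⟩ : F.underlying.edgeSet)) ?_
    rintro ⟨e, he⟩
    induction e using Sym2.ind with
    | _ u v =>
    have hmain : ∀ u v : F.verts, ∀ a ∈ F.arcs, D.tail a = u → D.head a = v →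
        ∃ w, s((⟨D.tail (f w), F.tail_mem _ (hf w)⟩ : F.verts), w.1) = s(u, v) := by
      intro u v a ha hau hav
      refine ⟨⟨v, fun e => hroot a ha (hav.trans (congrArg Subtype.val e))⟩, ?_⟩
      have := hsame _ (hf ⟨v, fun e => hroot a ha (hav.trans (congrArg Subtype.val e))⟩) a ha
        ((hfh _).trans hav.symm)
      exact congrArg (fun x => s(x, v)) (Subtype.ext ((congrArg D.tail this).trans hau))
    obtain ⟨a, ha, ⟨hau, hav⟩ | ⟨hav, hau⟩⟩ := he
    · obtain ⟨w, hw⟩ := hmain u v a ha hau hav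
      exact ⟨w, Subtype.ext hw⟩
    · obtain ⟨w, hw⟩ := hmain v u a ha hav hau
      exact ⟨w, Subtype.ext (hw.trans Sym2.eq_swap)⟩
  · intro a ha b hb hab
    rcases Sym2.eq_iff.1 hab with ⟨-, h₂⟩ | ⟨h₁, h₂⟩
    · exact hsame a ha b hb h₂
    · have h₃ := hlt a ha
      have h₄ := hlt b hb
      rw [h₁, h₂] at h₃
      omega
  · obtain ⟨p, hp, hpu⟩ := (hwalk _ u hu rfl).1
    exact ⟨p, hp.isDirPath hlt, fun q hq => hpu q hq.1⟩

end Subdigraph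

/-- `F` is the arc set of a spanning forest of arborescences rooted at the vertices of `W`, as
witnessed by a height `h` and the map `ρ` of each vertex to the root of its component. -/
structure IsRootedForest (D : MultiDigraph V A) (W : Finset V) (F : Finset A) (h : V → ℕ)
    (ρ : V → V) : Prop where
  height_lt : ∀ a ∈ F, h (D.tail a) < h (D.head a)
  root_eq : ∀ a ∈ F, ρ (D.tail a) = ρ (D.head a)
  root_self : ∀ u ∈ W, ρ u = u
  height_root : ∀ u ∈ W, h u = 0
  head_notMem : ∀ a ∈ F, D.head a ∉ W
  existsUnique_arc : ∀ v ∉ W, ∃! a, a ∈ F ∧ D.head a = v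

theorem Spans.exists_isRootedForest [Fintype V] [DecidableEq V] [DecidableEq A] {W : Finset V}
    {F : Finset A} (hF : D.Spans W F) : ∃ h ρ, D.IsRootedForest W F h ρ := by
  induction hF with
  | univ => exact ⟨fun _ => 0, id, by constructor <;> simp⟩
  | step a W F ht hh _ ih =>
    obtain ⟨h, ρ, hyp⟩ := ih
    have hta : D.tail a ∈ insert (D.head a) W := Finset.mem_insert_of_mem ht
    have hout : ∀ b ∈ F, D.head b ∉ W := fun b hb hbW =>
      hyp.head_notMem b hb (Finset.mem_insert_of_mem hbW)
    have hne : ∀ b ∈ F, D.head b ≠ D.head a := fun b hb e =>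
      hyp.head_notMem b hb (e ▸ Finset.mem_insert_self _ _)
    -- The tree rooted at the head of `a` is hung below the tail of `a`, itself a root. Heights
    -- outside `W` shift by one, to lie above the roots.
    refine ⟨fun x => if x ∈ W then 0 else h x + 1,
      fun x => if ρ x = D.head a then D.tail a else ρ x, ?_, ?_, ?_, ?_, ?_, ?_⟩
    · intro b hb
      rcases Finset.mem_insert.1 hb with rfl | hb
      · simp [ht, hh]
      · have := hyp.height_lt b hb
        simp only [if_neg (hout b hb)]
        split_ifs <;> omega
    · intro b hb
      rcases Finset.mem_insert.1 hb with rfl | hb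
      · simp [hyp.root_self _ hta, hyp.root_self _ (Finset.mem_insert_self _ _)]
      · simp only [hyp.root_eq b hb]
    · intro u hu
      have hu' := hyp.root_self u (Finset.mem_insert_of_mem hu)
      have : u ≠ D.head a := fun e => hh (e ▸ hu)
      simp [hu', this]
    · intro u hu
      simp [hu]
    · intro b hb
      rcases Finset.mem_insert.1 hb with rfl | hb
      · exact hh
      · exact hout b hb
    · intro v hv
      by_cases hva : v = D.head a
      · subst hva
        refine ⟨a, ⟨Finset.mem_insert_self _ _, rfl⟩, fun b hb => ?_⟩
        exact (Finset.mem_insert.1 hb.1).resolve_right fun hbF => hne b hbF hb.2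
      · obtain ⟨b, hb, hbu⟩ := hyp.existsUnique_arc v (by simp [hva, hv])
        refine ⟨b, ⟨Finset.mem_insert_of_mem hb.1, hb.2⟩, fun b' hb' => hbu b' ⟨?_, hb'.2⟩⟩
        refine (Finset.mem_insert.1 hb'.1).resolve_left ?_
        rintro rfl
        exact hva hb'.2.symm

/-- The spanning subdigraph with a given arc set. -/
def spanning (D : MultiDigraph V A) (F : Finset A) : D.Subdigraph where
  verts := Set.univ
  arcs := F
  tail_mem _ _ := Set.mem_univ _
  head_mem _ _ := Set.mem_univ _

namespace IsRootedForest

variable {W : Finset V} {F : Finset A} {h : V → ℕ} {ρ : V → V}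

theorem root_mem_and_reachable (H : D.IsRootedForest W F h ρ) (v : V) :
    ρ v ∈ W ∧ (D.spanning F).underlying.Reachable ⟨ρ v, Set.mem_univ _⟩ ⟨v, Set.mem_univ _⟩ := by
  induction hn : h v using Nat.strong_induction_on generalizing v with
  | _ n ih =>
  by_cases hv : v ∈ W
  · have := H.root_self v hv
    simp only [this]
    exact ⟨hv, SimpleGraph.Reachable.refl _⟩
  · obtain ⟨a, ⟨ha, rfl⟩, -⟩ := H.existsUnique_arc v hv
    obtain ⟨h₁, h₂⟩ := ih _ (hn ▸ H.height_lt a ha) (D.tail a) rfl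
    simp only [H.root_eq a ha] at h₁ h₂
    exact ⟨h₁, h₂.trans (SimpleGraph.Adj.reachable ⟨a, ha, Or.inl ⟨rfl, rfl⟩⟩)⟩

theorem root_eq_of_reachable (H : D.IsRootedForest W F h ρ) {u v : (D.spanning F).verts}
    (huv : (D.spanning F).underlying.Reachable u v) : ρ u = ρ v := by
  obtain ⟨w⟩ := huv
  induction w with
  | nil => rfl
  | cons hadj _ ih =>
    rw [← ih]
    obtain ⟨a, ha, ⟨h₁, h₂⟩ | ⟨h₁, h₂⟩⟩ := hadj
    · rw [← h₁, ← h₂, H.root_eq a ha]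
    · rw [← h₁, ← h₂, H.root_eq a ha]

theorem mem_component_verts_iff (H : D.IsRootedForest W F h ρ) {u v : V} :
    v ∈ ((D.spanning F).component
      ((D.spanning F).underlying.connectedComponentMk ⟨u, Set.mem_univ _⟩)).verts ↔
      ρ v = ρ u := by
  constructor
  · rintro ⟨-, x, hx, rfl⟩
    exact H.root_eq_of_reachable (SimpleGraph.ConnectedComponent.eq.1 hx)
  · intro e
    refine ⟨Set.mem_univ _, ⟨v, Set.mem_univ _⟩, ?_, rfl⟩
    have h₁ := (H.root_mem_and_reachable v).2
    have h₂ := (H.root_mem_and_reachable u).2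
    simp only [e] at h₁
    exact SimpleGraph.ConnectedComponent.eq.2 (h₁.symm.trans h₂)

theorem mem_component_arcs_iff (H : D.IsRootedForest W F h ρ) {u : V} {a : A} :
    a ∈ ((D.spanning F).component
      ((D.spanning F).underlying.connectedComponentMk ⟨u, Set.mem_univ _⟩)).arcs ↔
      a ∈ F ∧ ρ (D.head a) = ρ u := by
  have hmem := fun v => H.mem_component_verts_iff (u := u) (v := v)
  constructor
  · rintro ⟨ha, -, h₂⟩
    exact ⟨ha, (hmem _).1 ⟨Set.mem_univ _, h₂⟩⟩
  · rintro ⟨ha, h₂⟩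
    exact ⟨ha, ((hmem _).2 ((H.root_eq a ha).trans h₂)).2, ((hmem _).2 h₂).2⟩

theorem isArborescence_component [Finite V] (H : D.IsRootedForest W F h ρ) (u : V) :
    ((D.spanning F).component
      ((D.spanning F).underlying.connectedComponentMk ⟨u, Set.mem_univ _⟩)).IsArborescence
        (ρ u) := by
  have hu := (H.root_mem_and_reachable u).1
  have hρ := H.root_self _ hu
  refine Subdigraph.isArborescence_of_existsUnique (h := h) ?_ ?_ ?_ ?_
  · exact H.mem_component_verts_iff.2 hρ
  · intro a ha
    exact H.height_lt a (H.mem_component_arcs_iff.1 ha).1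
  · intro a ha e
    exact H.head_notMem a (H.mem_component_arcs_iff.1 ha).1 (e ▸ hu)
  · intro v hv hne
    rw [H.mem_component_verts_iff] at hv
    have hvW : v ∉ W := fun hvW => hne ((H.root_self v hvW).symm.trans hv)
    obtain ⟨a, ha, hau⟩ := H.existsUnique_arc v hvW
    refine ⟨a, ⟨H.mem_component_arcs_iff.2 ⟨ha.1, ha.2 ▸ hv⟩, ha.2⟩, fun b hb => ?_⟩
    exact hau b ⟨(H.mem_component_arcs_iff.1 hb.1).1, hb.2⟩

theorem isBranching [Finite V] (H : D.IsRootedForest W F h ρ) : (D.spanning F).IsBranching := by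
  refine ⟨rfl, fun C => ?_⟩
  induction C using SimpleGraph.ConnectedComponent.ind with
  | _ u => exact ⟨ρ u, H.isArborescence_component u⟩

theorem rootSet_eq [Finite V] (H : D.IsRootedForest W F h ρ) :
    (D.spanning F).rootSet = W := by
  ext r
  constructor
  · rintro ⟨C, hC⟩
    induction C using SimpleGraph.ConnectedComponent.ind with
    | _ u =>
    by_contra hr
    -- A root outside `W` would have an entering arc whose tail it reaches, yet heights increase
    -- along walks and along that arc.
    obtain ⟨a, ⟨ha, rfl⟩, -⟩ := H.existsUnique_arc r hr
    have hra := H.mem_component_verts_iff.1 hC.1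
    obtain ⟨p, hp, -⟩ := hC.2.2 (D.tail a)
      (H.mem_component_verts_iff.2 ((H.root_eq a ha).trans hra))
    have := (hp.1.pairwise_lt (h := h)
      fun b hb => H.height_lt b (H.mem_component_arcs_iff.1 hb).1).1
    exact absurd (H.height_lt a ha) (not_lt.2 this)
  · intro hr
    exact ⟨_, by simpa only [H.root_self r hr] using H.isArborescence_component r⟩

end IsRootedForest

end MultiDigraph

/-! ### Necessity of the condition. -/

namespace MultiDigraph

variable {V A : Type*} {D : MultiDigraph V A}

namespace Subdigraph

theorem IsDirWalk.exists_entering {F : D.Subdigraph} {X : Finset V} {u v : V} {p : List A}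
    (hp : F.IsDirWalk u p v) (hu : u ∉ X) (hv : v ∈ X) :
    ∃ a ∈ F.arcs, D.tail a ∉ X ∧ D.head a ∈ X := by
  induction p generalizing u with
  | nil => exact absurd (hp.2 ▸ hv) hu
  | cons b p ih =>
    obtain ⟨hb, rfl, hp⟩ := hp
    by_cases hh : D.head b ∈ X
    · exact ⟨b, hb, hu, hh⟩
    · exact ih hp hh

/-- The path to a vertex of `X` from the root of its component starts outside `X`. -/
theorem IsBranching.exists_entering {B : D.Subdigraph} (hB : B.IsBranching) {X : Finset V}
    (hX : X.Nonempty) (hroot : ∀ r ∈ B.rootSet, r ∉ X) :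
    ∃ a ∈ B.arcs, D.tail a ∉ X ∧ D.head a ∈ X := by
  obtain ⟨x, hx⟩ := hX
  have hxB : x ∈ B.verts := hB.1 ▸ Set.mem_univ x
  obtain ⟨r, hr⟩ := hB.2 (B.underlying.connectedComponentMk ⟨x, hxB⟩)
  obtain ⟨p, hp, -⟩ := hr.2.2 x ⟨hxB, ⟨x, hxB⟩, rfl, rfl⟩
  obtain ⟨a, ha, h⟩ := hp.1.exists_entering (hroot r ⟨_, hr⟩) hx
  exact ⟨a, ha.1, h⟩

end Subdigraph

variable [Fintype A] [DecidableEq V] {k : ℕ}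

theorem card_missedBy_rootSet_le {B : Fin k → D.Subdigraph} (hB : ∀ i, (B i).IsBranching)
    (hdis : ∀ i j, i ≠ j → Disjoint (B i).arcs (B j).arcs) {R : Fin k → Finset V}
    (hR : ∀ i, (R i : Set V) = (B i).rootSet) {X : Finset V} (hX : X.Nonempty)
    (J : Finset (Fin k)) : (missedBy R J X).card ≤ D.inDegree X := by
  have hex : ∀ i : {i // i ∈ missedBy R J X}, ∃ a ∈ (B i).arcs, D.tail a ∉ X ∧ D.head a ∈ X := by
    rintro ⟨i, hi⟩
    refine (hB i).exists_entering hX fun r hr hrX => ?_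
    rw [← hR i, Finset.mem_coe] at hr
    exact Finset.notMem_empty r ((Finset.mem_filter.1 hi).2 ▸ Finset.mem_inter.2 ⟨hrX, hr⟩)
  choose f hf hfX using hex
  rw [← Finset.card_attach]
  refine Finset.card_le_card_of_injOn f (fun i _ => by simpa using hfX i) ?_
  intro i _ j _ hij
  by_contra hne
  exact Set.disjoint_left.1 (hdis i j fun e => hne (Subtype.ext e)) (hf i) (hij ▸ hf j)

theorem sum_card_missedBy_sub_le {B : Fin k → D.Subdigraph} (hB : ∀ i, (B i).IsBranching)
    (hdis : ∀ i j, i ≠ j → Disjoint (B i).arcs (B j).arcs) {R U : Fin k → Finset V}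
    (hR : ∀ i, (R i : Set V) = (B i).rootSet) (hUR : U ≤ R) {t : ℕ} {X : Fin t → Finset V}
    (hX : ∀ j, (X j).Nonempty) (hXd : ∀ j j', j ≠ j' → Disjoint (X j) (X j'))
    (J : Finset (Fin k)) :
    ∑ j, (((missedBy U J (X j)).card : ℤ) - (D.inDegree (X j) : ℤ)) ≤
      ∑ i ∈ J, (((R i).card : ℤ) - ((U i).card : ℤ)) := by
  have h₁ : ∀ j, (missedBy U J (X j)).card ≤
      D.inDegree (X j) + ∑ i ∈ J, (X j ∩ (R i \ U i)).card := by
    intro j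
    refine le_trans ?_ (Nat.add_le_add_right (card_missedBy_rootSet_le hB hdis hR (hX j) J) _)
    rw [missedBy, missedBy, Finset.card_filter, Finset.card_filter, ← Finset.sum_add_distrib]
    refine Finset.sum_le_sum fun i _ => ?_
    split_ifs with hU hR'
    · omega
    · obtain ⟨v, hv⟩ := Finset.nonempty_iff_ne_empty.2 hR'
      rw [Finset.mem_inter] at hv
      have hvU : v ∉ U i := fun h =>
        Finset.notMem_empty v (hU ▸ Finset.mem_inter.2 ⟨hv.1, h⟩)
      have : 0 < (X j ∩ (R i \ U i)).card := Finset.card_pos.2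
        ⟨v, Finset.mem_inter.2 ⟨hv.1, Finset.mem_sdiff.2 ⟨hv.2, hvU⟩⟩⟩
      omega
    · omega
    · omega
  have h₂ : ∀ i, ∑ j, (X j ∩ (R i \ U i)).card ≤ (R i \ U i).card := by
    intro i
    rw [← Finset.card_biUnion fun j _ j' _ hj =>
      (hXd j j' hj).mono Finset.inter_subset_left Finset.inter_subset_left]
    exact Finset.card_le_card (Finset.biUnion_subset.2 fun j _ => Finset.inter_subset_right)
  calc ∑ j, (((missedBy U J (X j)).card : ℤ) - (D.inDegree (X j) : ℤ))
      ≤ ∑ j, ∑ i ∈ J, ((X j ∩ (R i \ U i)).card : ℤ) := by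
        refine Finset.sum_le_sum fun j _ => ?_
        rw [sub_le_iff_le_add']
        exact_mod_cast h₁ j
    _ = ∑ i ∈ J, ∑ j, ((X j ∩ (R i \ U i)).card : ℤ) := Finset.sum_comm
    _ ≤ ∑ i ∈ J, (((R i).card : ℤ) - ((U i).card : ℤ)) := by
        refine Finset.sum_le_sum fun i _ => ?_
        have h₃ := Finset.card_sdiff_add_card_eq_card (hUR i)
        have h₄ : ∑ j, ((X j ∩ (R i \ U i)).card : ℤ) ≤ ((R i \ U i).card : ℤ) := by
          exact_mod_cast h₂ i
        omega

end MultiDigraph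

/-! ### Block partitions and the equivalence. -/

theorem IsBlockPartition.exists_block {k l : ℕ} {I : Fin l → Finset (Fin k)}
    (hI : IsBlockPartition I) : ∃ col : Fin k → Fin l, ∀ α i, i ∈ I α ↔ col i = α := by
  have : ∀ i, ∃ α, i ∈ I α := fun i => by
    have := hI.2.2 ▸ Finset.mem_univ i
    simpa using this
  choose col hcol using this
  refine ⟨col, fun α i => ⟨fun h => ?_, fun h => h ▸ hcol i⟩⟩
  by_contra hne
  exact Finset.disjoint_left.1 (hI.2.1 _ _ hne) (hcol i) h

/-- Nonemptiness of the blocks matters: an empty block would lie in every union. -/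
theorem IsBlockPartition.filter_subset_biUnion {k l : ℕ} {I : Fin l → Finset (Fin k)}
    (hI : IsBlockPartition I) (S : Finset (Fin l)) :
    (Finset.univ.filter fun α => I α ⊆ S.biUnion I) = S := by
  ext α
  rw [Finset.mem_filter]
  refine ⟨fun h => ?_, fun h => ⟨Finset.mem_univ _, Finset.subset_biUnion_of_mem I h⟩⟩
  obtain ⟨i, hi⟩ := hI.1 α
  obtain ⟨β, hβ, hiβ⟩ := Finset.mem_biUnion.1 (h.2 hi)
  by_cases hαβ : α = β
  · exact hαβ ▸ hβ
  · exact absurd hiβ (Finset.disjoint_left.1 (hI.2.1 _ _ hαβ) hi)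

theorem corollary4p10 {V A : Type*} [Fintype V] [DecidableEq V] [Fintype A]
    (D : MultiDigraph V A) {k l : ℕ} (hk : 0 < k)
    (I : Fin l → Finset (Fin k)) (hI : IsBlockPartition I)
    (c' : Fin l → ℕ) (U : Fin k → Finset V)
    (hU : ∀ α, ∑ i ∈ I α, (U i).card ≤ c' α) :
    (∃ B : Fin k → D.Subdigraph,
        (∀ i, (B i).IsBranching) ∧
        (∀ i j, i ≠ j → Disjoint (B i).arcs (B j).arcs) ∧
        (∀ i, (U i : Set V) ⊆ (B i).rootSet) ∧
        ∀ α, ∑ i ∈ I α, (B i).rootSet.ncard ≤ c' α) ↔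
      ∀ (t : ℕ) (X : Fin t → Finset V),
        (∀ j, (X j).Nonempty) →
        (∀ j j', j ≠ j' → Disjoint (X j) (X j')) →
        ∀ S : Finset (Fin l), ∀ J : Finset (Fin k), J = S.biUnion I →
          ∑ j, (((missedBy U J (X j)).card : ℤ) - (D.inDegree (X j) : ℤ)) ≤
            ∑ α with I α ⊆ J, ((c' α : ℤ) - ∑ i ∈ I α, ((U i).card : ℤ)) := by
  classical
  constructor
  · rintro ⟨B, hB, hdis, hUB, hc⟩ t X hX hXd S J rfl
    have hR : ∀ i, (((B i).rootSet.toFinite.toFinset : Finset V) : Set V) = (B i).rootSet :=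
      fun i => Set.Finite.coe_toFinset _
    refine (MultiDigraph.sum_card_missedBy_sub_le hB hdis hR (U := U)
      (fun i v hv => by simpa using hUB i hv) hX hXd _).trans ?_
    rw [hI.filter_subset_biUnion, Finset.sum_biUnion fun α _ β _ h => hI.2.1 α β h]
    refine Finset.sum_le_sum fun α _ => ?_
    rw [Finset.sum_sub_distrib]
    refine Int.sub_le_sub_right ?_ _
    have := hc α
    simp only [Set.ncard_eq_toFinset_card _ (Set.toFinite _)] at this
    exact_mod_cast this
  · intro h
    obtain ⟨col, hcol⟩ := hI.exists_block
    have hcond : PackingCondition D.inDegree I c' U := by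
      intro M hne hdis S
      have := h M.card (fun j => (M.equivFin.symm j).1) (fun j => hne _ (M.equivFin.symm j).2)
        (fun j j' hj => hdis _ (M.equivFin.symm j).2 _ (M.equivFin.symm j').2
          fun e => hj (M.equivFin.symm.injective (Subtype.ext e))) S _ rfl
      rw [hI.filter_subset_biUnion, Equiv.sum_comp M.equivFin.symm
        (fun X : M => ((missedBy U (S.biUnion I) X.1).card : ℤ) - (D.inDegree X.1 : ℤ))] at this
      rwa [← Finset.sum_coe_sort M]
    obtain ⟨R, hUR, hcR, hR⟩ := hcond.exists_roots
      (fun X Y => D.card_entering_inter_add_union_le Finset.univ X Y) hcol hU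
    obtain ⟨F, -, hdis, hF⟩ := MultiDigraph.exists_disjoint_spans (D := D) (E := Finset.univ) hR
    choose ht ρ H using fun i => (hF i).exists_isRootedForest
    refine ⟨fun i => D.spanning (F i), fun i => (H i).isBranching, fun i j hij => ?_, fun i => ?_,
      fun α => ?_⟩
    · exact Finset.disjoint_coe.2 (hdis i j hij)
    · rw [(H i).rootSet_eq]
      exact Finset.coe_subset.2 (hUR i)
    · simpa only [(H _).rootSet_eq, Set.ncard_coe_finset] using hcR α
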